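/- Let $0<s<1$, and let $L(dz)$ be the Lebesgue measure on $\mathbb{C}\simeq\mathbb{R}^2$. Let $\mathscr{X}_s(\mathbb{C})$ be the space of entire functions $\varphi$ with $$\int_{\mathbb{C}}|\varphi(z)|^2\exp\Bigl(-\frac{1-s^2}{2s}|z|^2+\frac{1+s^2}{4s}(z^2+\bar z^2)\Bigr)L(dz)<\infty,$$ and let $\mathscr{H}_B(\mathbb{C})$ be the space of entire functions $\varphi$ with $\int_{\mathbb{C}}|\varphi(z)|^2e^{-|z|^2/2}L(dz)<\infty$, each with the corresponding weighted $L^2$ inner product. For $f\in L^2(\mathbb{R})$ let $$Bf(z)=2^{-1/2}\pi^{-3/4}\int_{\mathbb{R}}e^{-z^2/4+zx-x^2/2}f(x)\,dx,\quad z\in\mathbb{C},$$ be its standard Bargmann transform. Let $a,b,c\in\mathbb{C}$ with $b\neq0$ and $\operatorname{Im}c>0$, put $\phi(z,x)=\frac a2z^2+bzx+\frac c2x^2$, $C_\phi=2^{-1/2}\pi^{-3/4}|b|(\operatorname{Im}c)^{-1/4}$, $$\Phi(z)=\frac{|bz|^2}{4\operatorname{Im}c}-\frac{b^2z^2+\bar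 b^2\bar z^2}{8\operatorname{Im}c}-\frac{az^2-\bar a\bar z^2}{4i},$$ and let $T:L^2(\mathbb{R})\to L^2_\Phi(\mathbb{C})=L^2(\mathbb{C},e^{-2\Phi(z)}L(dz))$ be the Bargmann-type transform $$Tf(z)=C_\phi\int_{\mathbb{R}}e^{i\phi(z,x)}f(x)\,dx,\quad z\in\mathbb{C},$$ with adjoint $T^\ast:L^2_\Phi(\mathbb{C})\to L^2(\mathbb{R})$. If $$\frac{1-s^2}{4s}=\frac{|b|^2}{4\operatorname{Im}c},\qquad \frac{1+s^2}{4s}=\frac{b^2}{4\operatorname{Im}c}+\frac{a}{2i},$$ then $\mathscr{X}_s(\mathbb{C})\subset L^2_\Phi(\mathbb{C})$, and $B\circ T^\ast$ is a Hilbert space isomorphism of $\mathscr{X}_s(\mathbb{C})$ onto $\mathscr{H}_B(\mathbb{C})$: it is linear, bijective, and preserves inner products. -/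

import Mathlib

noncomputable section

open MeasureTheory Complex
open scoped ComplexConjugate ENNReal FourierTransform

namespace Bargmann

/-- Coefficients of a quadratic phase `φ(z, x) = a z² / 2 + b z x + c x² / 2`, `z ∈ ℂ`, `x ∈ ℝ`,
with `b ≠ 0` and `Im c > 0`. -/
structure QuadraticPhase where
  a : ℂ
  b : ℂ
  c : ℂ
  b_ne_zero : b ≠ 0
  im_c_pos : 0 < c.im

/-- The measure `e^{-q(z)} L(dz)` on `ℂ`, where `L` is the Lebesgue measure. -/
def expMeasure (q : C(ℂ, ℝ)) : Measure ℂ :=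
  volume.withDensity fun z => ENNReal.ofReal (Real.exp (-q z))

/-- The entire functions that are square integrable with respect to `e^{-q(z)} L(dz)`. -/
def entireL2 (q : C(ℂ, ℝ)) : Submodule ℂ (ℂ → ℂ) where
  carrier := {φ | Differentiable ℂ φ ∧ MemLp φ 2 (expMeasure q)}
  add_mem' h₁ h₂ := ⟨h₁.1.add h₂.1, h₁.2.add h₂.2⟩
  zero_mem' := ⟨differentiable_const 0, MemLp.zero⟩
  smul_mem' r _ h := ⟨h.1.const_smul r, h.2.const_smul r⟩

/-- The space of entire functions that are square integrable with respect to `e^{-q(z)} L(dz)`,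
as a type of its own (so that it carries its Hilbert space norm, and not the topology of pointwise
convergence). -/
def EntireL2 (q : C(ℂ, ℝ)) : Type := entireL2 q

namespace EntireL2

variable {q : C(ℂ, ℝ)}

instance : AddCommGroup (EntireL2 q) := inferInstanceAs (AddCommGroup (entireL2 q))

instance : Module ℂ (EntireL2 q) := inferInstanceAs (Module ℂ (entireL2 q))

instance : CoeFun (EntireL2 q) (fun _ => ℂ → ℂ) := ⟨fun φ => φ.1⟩

theorem differentiable (φ : EntireL2 q) : Differentiable ℂ φ := φ.2.1

theorem memLp (φ : EntireL2 q) : MemLp φ 2 (expMeasure q) := φ.2.2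

/-- The inner product `∫ conj φ(z) ψ(z) e^{-q(z)} L(dz)`; it is linear in the second variable, as
always in Mathlib. -/
instance : Inner ℂ (EntireL2 q) where
  inner φ ψ := ∫ z, conj (φ z) * ψ z * Real.exp (-q z)

theorem volume_ac (q : C(ℂ, ℝ)) : volume ≪ expMeasure q := by
  refine withDensity_absolutelyContinuous' (by fun_prop) (Filter.Eventually.of_forall fun z => ?_)
  simpa using Real.exp_pos _

theorem inner_eq (φ ψ : EntireL2 q) :
    inner ℂ φ ψ = inner ℂ (φ.memLp.toLp φ) (ψ.memLp.toLp ψ) := by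
  rw [L2.inner_def]
  have h : ∫ z, inner ℂ (φ.memLp.toLp φ z) (ψ.memLp.toLp ψ z) ∂expMeasure q
      = ∫ z, conj (φ z) * ψ z ∂expMeasure q := by
    refine integral_congr_ae ?_
    filter_upwards [φ.memLp.coeFn_toLp, ψ.memLp.coeFn_toLp] with z h₁ h₂
    rw [h₁, h₂, RCLike.inner_apply, mul_comm]
  rw [h, expMeasure, integral_withDensity_eq_integral_toReal_smul (by fun_prop) (by simp)]
  refine integral_congr_ae (Filter.Eventually.of_forall fun z => ?_)
  simp only [ENNReal.toReal_ofReal (Real.exp_pos _).le, Complex.real_smul]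
  ring

theorem eq_zero_of_toLp (φ : EntireL2 q) (h : φ.memLp.toLp φ = 0) : φ = 0 := by
  have h₁ : ⇑φ =ᵐ[expMeasure q] fun _ => (0 : ℂ) :=
    φ.memLp.coeFn_toLp.symm.trans (h ▸ Lp.coeFn_zero ℂ 2 (expMeasure q))
  have h₂ := (Continuous.ae_eq_iff_eq volume φ.differentiable.continuous
    continuous_const).1 ((volume_ac q).ae_le h₁)
  exact Subtype.ext h₂

/-- The inner product space axioms. -/
abbrev innerCore (q : C(ℂ, ℝ)) : InnerProductSpace.Core ℂ (EntireL2 q) where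
  conj_inner_symm φ ψ := by
    rw [inner_eq, inner_eq]; exact inner_conj_symm _ _
  re_inner_nonneg φ := by
    rw [inner_eq]; exact inner_self_nonneg
  add_left φ ψ χ := by
    rw [inner_eq, inner_eq, inner_eq, ← inner_add_left]; rfl
  smul_left φ ψ r := by
    rw [inner_eq, inner_eq, ← inner_smul_left]; rfl
  definite φ h := by
    rw [inner_eq, inner_self_eq_zero] at h
    exact eq_zero_of_toLp φ h

instance : NormedAddCommGroup (EntireL2 q) := (innerCore q).toNormedAddCommGroup

instance : InnerProductSpace ℂ (EntireL2 q) := InnerProductSpace.ofCore (innerCore q).toCore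

end EntireL2

/-- The standard Segal-Bargmann space: the entire functions that are square integrable with respect
to `e^{-|z|²/2} L(dz)`. -/
abbrev HB : Type := EntireL2 ⟨fun z => ‖z‖ ^ 2 / 2, by fun_prop⟩

/-- The space `X_s` of the entire functions that are square integrable with respect to
`exp (-(1 - s²) / (2s) |z|² + (1 + s²) / (4s) (z² + conj z²)) L(dz)`. -/
abbrev X (s : ℝ) : Type :=
  EntireL2 ⟨fun z => (1 - s ^ 2) / (2 * s) * ‖z‖ ^ 2
    - (1 + s ^ 2) / (4 * s) * (z ^ 2 + conj z ^ 2).re, by fun_prop⟩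

namespace QuadraticPhase

variable (P : QuadraticPhase)

/-- The phase function `φ(z, x)`. -/
def phase (z : ℂ) (x : ℝ) : ℂ := P.a / 2 * z ^ 2 + P.b * z * x + P.c / 2 * x ^ 2

/-- The normalizing constant `C_φ = 2^{-1/2} π^{-3/4} |b| (Im c)^{-1/4}`. -/
def const : ℝ :=
  (2 : ℝ) ^ (-(1 / 2) : ℝ) * Real.pi ^ (-(3 / 4) : ℝ) * ‖P.b‖ * P.c.im ^ (-(1 / 4) : ℝ)

/-- The Bargmann-type transform `Tf(z) = C_φ ∫ e^{iφ(z, x)} f(x) dx`. The integral converges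
absolutely for every `f ∈ L²(ℝ)` and every `z ∈ ℂ`. -/
def transform (f : ℝ → ℂ) (z : ℂ) : ℂ :=
  P.const * ∫ x : ℝ, exp (I * P.phase z x) * f x

/-- The weight function
`Φ(z) = |bz|² / (4 Im c) - (b² z² + conj (b² z²)) / (8 Im c) - (a z² - conj (a z²)) / (4i)`,
where the last two terms are real. -/
def Phi : C(ℂ, ℝ) where
  toFun z := ‖P.b * z‖ ^ 2 / (4 * P.c.im)
    - (P.b ^ 2 * z ^ 2 + conj P.b ^ 2 * conj z ^ 2).re / (8 * P.c.im)
    - ((P.a * z ^ 2 - conj P.a * conj z ^ 2) / (4 * I)).re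
  continuous_toFun := by fun_prop

/-- The space `L²_Φ(ℂ) = L²(ℂ, e^{-2Φ(z)} L(dz))`. -/
abbrev L2Phi : Type := Lp ℂ 2 (expMeasure (2 • P.Phi))



/-- Plancherel's theorem for functions in `L¹(ℝ) ∩ L²(ℝ)`. -/
theorem lintegral_fourier (g : ℝ → ℂ) (h₁ : Integrable g) (h₂ : MemLp g 2) :
    ∫⁻ ξ, ‖𝓕 g ξ‖ₑ ^ 2 = ∫⁻ x, ‖g x‖ₑ ^ 2 := by
  have key : 𝓕 g =ᵐ[volume] (𝓕 (h₂.toLp g) : Lp ℂ 2 (volume : Measure ℝ)) := by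
    refine ae_eq_of_integral_contDiff_smul_eq ?_ ?_ ?_
    · exact (VectorFourier.fourierIntegral_continuous Real.continuous_fourierChar
        (by fun_prop) h₁).locallyIntegrable
    · exact (Lp.memLp _).locallyIntegrable (by norm_num)
    · intro u hu hc
      have hu' : ContDiff ℝ (⊤ : ℕ∞) (fun x => (u x : ℂ)) :=
        ofRealCLM.contDiff.comp hu
      have hc' : HasCompactSupport (fun x => (u x : ℂ)) := hc.comp_left (g := ((↑) : ℝ → ℂ)) rfl
      let v := hc'.toSchwartzMap hu'
      have e := congrArg (fun D => D v) (Lp.fourier_toTemperedDistribution_eq (h₂.toLp g))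
      simp only [TemperedDistribution.fourier_apply, Lp.toTemperedDistribution_apply] at e
      have e₂ : ∫ x, 𝓕 v x • (h₂.toLp g) x = ∫ x, 𝓕 v x • g x := by
        refine integral_congr_ae ?_
        filter_upwards [h₂.coeFn_toLp] with x hx
        rw [hx]
      have e₃ := VectorFourier.integral_fourierIntegral_smul_eq_flip (μ := volume) (ν := volume)
        (L := innerₗ ℝ) Real.continuous_fourierChar (by fun_prop) v.integrable h₁
      rw [e₂] at e
      rw [SchwartzMap.fourier_coe] at e
      have e₄ : ∫ x, 𝓕 (v : ℝ → ℂ) x • g x = ∫ x, v x • 𝓕 g x := by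
        rw [flip_innerₗ] at e₃
        exact e₃
      rw [e₄] at e
      exact e
  have e : eLpNorm (𝓕 g) 2 volume = eLpNorm g 2 volume := by
    rw [eLpNorm_congr_ae key, ← eLpNorm_congr_ae h₂.coeFn_toLp]
    have := Lp.norm_fourier_eq (h₂.toLp g)
    rw [Lp.norm_def, Lp.norm_def, ENNReal.toReal_eq_toReal_iff' (Lp.eLpNorm_ne_top _)
      (Lp.eLpNorm_ne_top _)] at this
    exact this
  have e' := congrArg (fun t => t ^ 2) e
  simpa [eLpNorm_eq_lintegral_rpow_enorm_toReal, ← ENNReal.rpow_mul_natCast] using e'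

/-- Separation of the real and imaginary parts of `b z` in the exponential. -/
theorem exp_phase (z : ℂ) (x : ℝ) :
    exp (I * P.phase z x) = exp (I * P.a / 2 * z ^ 2) *
      (exp (↑((P.b * z).re * x) * I) * exp (-(P.b * z).im * x + I * P.c / 2 * x ^ 2)) := by
  rw [← exp_add, ← exp_add]
  congr 1
  have : P.b * z = (P.b * z).re + (P.b * z).im * I := (re_add_im _).symm
  rw [phase]
  generalize P.b * z = w at *
  conv_lhs => rw [this]
  push_cast
  linear_combination (w.im * x : ℂ) * I_sq

theorem memLp_kernel (v : ℝ) :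
    MemLp (fun x : ℝ => exp (-v * x + I * P.c / 2 * x ^ 2)) 2 := by
  refine (memLp_two_iff_integrable_sq_norm (by fun_prop)).2 ?_
  have h := (integrable_cexp_quadratic (b := P.c.im) (by simpa using P.im_c_pos)
    (-2 * v) 0).norm
  refine h.congr (Filter.Eventually.of_forall fun x => ?_)
  simp only [norm_exp, ← Real.exp_nat_mul]
  congr 1
  simp [← ofReal_pow]
  ring

theorem integrable_mul (v : ℝ) {f : ℝ → ℂ} (hf : MemLp f 2) :
    Integrable (fun x : ℝ => exp (-v * x + I * P.c / 2 * x ^ 2) * f x) :=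
  (P.memLp_kernel v).integrable_mul hf

theorem memLp_mul (v : ℝ) {f : ℝ → ℂ} (hf : MemLp f 2) :
    MemLp (fun x : ℝ => exp (-v * x + I * P.c / 2 * x ^ 2) * f x) 2 := by
  refine hf.of_le_mul (c := Real.exp (v ^ 2 / (2 * P.c.im)))
    ((by fun_prop : Continuous _).aestronglyMeasurable.mul hf.1)
    (Filter.Eventually.of_forall fun x => ?_)
  rw [norm_mul, norm_exp]
  refine mul_le_mul_of_nonneg_right (Real.exp_le_exp.2 ?_) (norm_nonneg _)
  have := P.im_c_pos
  rw [le_div_iff₀ (by positivity)]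
  simp [← ofReal_pow]
  nlinarith [sq_nonneg (v + P.c.im * x)]

theorem integrable_transform {f : ℝ → ℂ} (hf : MemLp f 2) (z : ℂ) :
    Integrable (fun x : ℝ => exp (I * P.phase z x) * f x) := by
  have h := ((P.integrable_mul (P.b * z).im hf).bdd_mul (c := 1)
    (f := fun x : ℝ => exp (↑((P.b * z).re * x) * I))
    (by fun_prop) (Filter.Eventually.of_forall fun x => by rw [norm_exp_ofReal_mul_I])).const_mul
      (exp (I * P.a / 2 * z ^ 2))
  refine h.congr (Filter.Eventually.of_forall fun x => ?_)
  simp only [exp_phase]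
  ring

/-- The modulus of the transform, through a Fourier transform in the real part of `b z`. -/
theorem norm_transform (f : ℝ → ℂ) (z : ℂ) :
    ‖P.transform f z‖ ^ 2 * Real.exp (-(2 • P.Phi) z) =
      P.const ^ 2 * Real.exp (-(P.b * z).im ^ 2 / P.c.im) *
        ‖𝓕 (fun x : ℝ => exp (-(P.b * z).im * x + I * P.c / 2 * x ^ 2) * f x)
          (-(2 * Real.pi)⁻¹ * (P.b * z).re)‖ ^ 2 := by
  have e₁ : ∫ x : ℝ, exp (I * P.phase z x) * f x = exp (I * P.a / 2 * z ^ 2) *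
      𝓕 (fun x : ℝ => exp (-(P.b * z).im * x + I * P.c / 2 * x ^ 2) * f x)
          (-(2 * Real.pi)⁻¹ * (P.b * z).re) := by
    rw [Real.fourier_real_eq_integral_exp_smul, ← integral_const_mul]
    congr 1
    ext x
    rw [exp_phase, smul_eq_mul]
    have : -2 * Real.pi * x * (-(2 * Real.pi)⁻¹ * (P.b * z).re) = (P.b * z).re * x := by
      field_simp [Real.pi_ne_zero]
    rw [this]
    ring
  have e₂ : ‖exp (I * P.a / 2 * z ^ 2)‖ ^ 2 * Real.exp (-(2 • P.Phi) z)
      = Real.exp (-(P.b * z).im ^ 2 / P.c.im) := by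
    rw [norm_exp, ← Real.exp_nat_mul, ← Real.exp_add]
    congr 1
    have hc := P.im_c_pos.ne'
    have n : ‖P.b * z‖ ^ 2 = (P.b * z).re ^ 2 + (P.b * z).im ^ 2 := by
      rw [← normSq_eq_norm_sq, normSq_apply]; ring
    have h₁ : (P.b ^ 2 * z ^ 2 + conj P.b ^ 2 * conj z ^ 2).re
        = 2 * ((P.b * z).re ^ 2 - (P.b * z).im ^ 2) := by
      simp [pow_two]; ring
    have h₂ : ((P.a * z ^ 2 - conj P.a * conj z ^ 2) / (4 * I)).re = (P.a * z ^ 2).im / 2 := by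
      have : P.a * z ^ 2 - conj P.a * conj z ^ 2 = (2 * (P.a * z ^ 2).im : ℝ) * I := by
        rw [← sub_conj]; simp
      rw [this, mul_div_mul_right _ _ I_ne_zero]
      norm_cast
      ring
    have h₃ : (I * P.a / 2 * z ^ 2).re = -(P.a * z ^ 2).im / 2 := by
      have : I * P.a / 2 * z ^ 2 = I * (P.a * z ^ 2) / (2 : ℝ) := by push_cast; ring
      rw [this, div_ofReal_re, I_mul_re]
    have h₄ : (2 • P.Phi) z = 2 * (‖P.b * z‖ ^ 2 / (4 * P.c.im)
      - (P.b ^ 2 * z ^ 2 + conj P.b ^ 2 * conj z ^ 2).re / (8 * P.c.im)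
      - ((P.a * z ^ 2 - conj P.a * conj z ^ 2) / (4 * I)).re) := by
      simp [Phi, two_mul]
    rw [h₄, n, h₁, h₂, h₃]
    field_simp
    push_cast
    ring
  rw [transform, e₁, norm_mul, norm_mul, ← e₂, norm_real, mul_pow, mul_pow, Real.norm_eq_abs,
    sq_abs]
  ring

theorem const_pos : 0 < P.const := by
  have := P.im_c_pos
  have := norm_pos_iff.2 P.b_ne_zero
  have := Real.pi_pos
  unfold const
  positivity

theorem const_sq : P.const ^ 2 * (2 * Real.pi) * √(Real.pi * P.c.im) = ‖P.b‖ ^ 2 := by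
  have hc := P.im_c_pos
  have hp := Real.pi_pos
  have h₁ : ((2 : ℝ) ^ (-(1 / 2) : ℝ)) ^ 2 * 2 = 1 := by
    rw [← Real.rpow_natCast, ← Real.rpow_mul (by norm_num)]
    norm_num [Real.rpow_neg_one]
  have h₂ : (Real.pi ^ (-(3 / 4) : ℝ)) ^ 2 * Real.pi * Real.pi ^ (1 / 2 : ℝ) = 1 := by
    rw [← Real.rpow_natCast, ← Real.rpow_mul hp.le, ← Real.rpow_add_one hp.ne',
      ← Real.rpow_add hp]
    norm_num
  have h₃ : (P.c.im ^ (-(1 / 4) : ℝ)) ^ 2 * P.c.im ^ (1 / 2 : ℝ) = 1 := by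
    rw [← Real.rpow_natCast, ← Real.rpow_mul hc.le, ← Real.rpow_add hc]
    norm_num
  rw [Real.sqrt_eq_rpow, Real.mul_rpow hp.le hc.le, const]
  calc _ = ‖P.b‖ ^ 2 * (((2 : ℝ) ^ (-(1 / 2) : ℝ)) ^ 2 * 2) *
        ((Real.pi ^ (-(3 / 4) : ℝ)) ^ 2 * Real.pi * Real.pi ^ (1 / 2 : ℝ)) *
        ((P.c.im ^ (-(1 / 4) : ℝ)) ^ 2 * P.c.im ^ (1 / 2 : ℝ)) := by ring
    _ = _ := by rw [h₁, h₂, h₃]; ring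

theorem lintegral_comp_const_mul (b : ℂ) (hb : b ≠ 0) {h : ℂ → ℝ≥0∞} (hh : Measurable h) :
    ENNReal.ofReal (‖b‖ ^ 2) * ∫⁻ z, h (b * z) = ∫⁻ w, h w := by
  let L : ℂ →ₗ[ℝ] ℂ := (LinearMap.mul ℂ ℂ b).restrictScalars ℝ
  have hd : LinearMap.det L = ‖b‖ ^ 2 := by
    have : LinearMap.det L = Algebra.norm ℝ (LinearMap.det (LinearMap.mul ℂ ℂ b)) :=
      LinearMap.det_restrictScalars
    rw [this, Algebra.norm_complex_apply, ← normSq_eq_norm_sq]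
    simp
  have hpos : 0 < ‖b‖ ^ 2 := by have := norm_pos_iff.2 hb; positivity
  have hm := Measure.map_linearMap_addHaar_eq_smul_addHaar (volume : Measure ℂ) (f := L)
    (by rw [hd]; exact hpos.ne')
  have : ∫⁻ z, h (b * z) = ∫⁻ w, h w ∂(Measure.map L volume) :=
    (lintegral_map hh (by exact (continuous_const_mul b).measurable)).symm
  rw [this, hm, hd, lintegral_smul_measure, smul_eq_mul, ← mul_assoc,
    ← ENNReal.ofReal_mul hpos.le, abs_of_pos (by positivity), mul_inv_cancel₀ hpos.ne']
  simp

theorem lintegral_comp_const_mul_real (a : ℝ) (ha : a ≠ 0) {h : ℝ → ℝ≥0∞} (hh : Measurable h) :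
    ∫⁻ x, h (a * x) = ENNReal.ofReal |a⁻¹| * ∫⁻ x, h x := by
  have : ∫⁻ x, h (a * x) = ∫⁻ w, h w ∂(Measure.map (a * ·) volume) :=
    (lintegral_map hh (by fun_prop)).symm
  rw [this, Real.map_volume_mul_left ha, lintegral_smul_measure, smul_eq_mul]

theorem lintegral_gaussian (c : ℝ) (hc : 0 < c) (x : ℝ) :
    ∫⁻ v : ℝ, ENNReal.ofReal (Real.exp (-(v + c * x) ^ 2 / c)) =
      ENNReal.ofReal √(Real.pi * c) := by
  rw [lintegral_add_right_eq_self (fun v => ENNReal.ofReal (Real.exp (-v ^ 2 / c))) (c * x)]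
  have h := integral_gaussian c⁻¹
  have hi := integrable_exp_neg_mul_sq (inv_pos.2 hc)
  rw [div_inv_eq_mul] at h
  rw [← h, ofReal_integral_eq_lintegral_ofReal hi
    (Filter.Eventually.of_forall fun x => (Real.exp_pos _).le)]
  congr 1
  ext v
  congr 2
  field_simp

theorem lintegral_transform {f : ℝ → ℂ} (hs : StronglyMeasurable f) (hf : MemLp f 2) :
    ∫⁻ z, ‖P.transform f z‖ₑ ^ 2 * ENNReal.ofReal (Real.exp (-(2 • P.Phi) z)) =
      ∫⁻ x, ‖f x‖ₑ ^ 2 := by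
  have hc := P.im_c_pos
  set F : ℝ → ℝ → ℂ := fun v =>
    𝓕 (fun x : ℝ => exp (-v * x + I * P.c / 2 * x ^ 2) * f x) with hF
  have hFm : Measurable fun p : ℝ × ℝ => F p.1 p.2 := by
    have : StronglyMeasurable fun p : ℝ × ℝ => ∫ x : ℝ, exp (↑(-2 * Real.pi * x * p.2) * I) •
        (exp (-p.1 * x + I * P.c / 2 * x ^ 2) * f x) := by
      refine StronglyMeasurable.integral_prod_right ?_
      have c₁ : Continuous fun q : (ℝ × ℝ) × ℝ =>
          exp (↑(-2 * Real.pi * q.2 * q.1.2) * I) := by fun_prop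
      have c₂ : Continuous fun q : (ℝ × ℝ) × ℝ =>
          exp (-q.1.1 * q.2 + I * P.c / 2 * q.2 ^ 2) := by fun_prop
      exact c₁.stronglyMeasurable.smul
        (c₂.stronglyMeasurable.mul (hs.comp_measurable measurable_snd))
    simpa only [hF, Real.fourier_real_eq_integral_exp_smul] using this.measurable
  set H : ℝ → ℝ → ℝ≥0∞ := fun u v => ENNReal.ofReal (P.const ^ 2 * Real.exp (-v ^ 2 / P.c.im)) *
    ‖F v (-(2 * Real.pi)⁻¹ * u)‖ₑ ^ 2 with hH
  have hHm : Measurable fun p : ℝ × ℝ => H p.1 p.2 := by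
    have : Measurable fun p : ℝ × ℝ => F p.2 (-(2 * Real.pi)⁻¹ * p.1) :=
      hFm.comp (f := fun p : ℝ × ℝ => (p.2, -(2 * Real.pi)⁻¹ * p.1)) (by fun_prop)
    fun_prop
  have e₁ : ∀ z, ‖P.transform f z‖ₑ ^ 2 * ENNReal.ofReal (Real.exp (-(2 • P.Phi) z)) =
      H (P.b * z).re (P.b * z).im := fun z => by
    simp only [hH]
    rw [← ofReal_norm, ← ofReal_norm, ← ENNReal.ofReal_pow (norm_nonneg _),
      ← ENNReal.ofReal_pow (norm_nonneg _), ← ENNReal.ofReal_mul (by positivity),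
      ← ENNReal.ofReal_mul (by positivity), norm_transform]
  have e₂ : ∀ v : ℝ, ∫⁻ u, H u v = ∫⁻ x, ENNReal.ofReal (P.const ^ 2 * (2 * Real.pi)) *
      (ENNReal.ofReal (Real.exp (-(v + P.c.im * x) ^ 2 / P.c.im)) * ‖f x‖ₑ ^ 2) := fun v => by
    have hFv : Measurable fun ξ => ‖F v ξ‖ₑ ^ 2 := by
      have : Measurable (F v) := hFm.comp (f := fun ξ : ℝ => (v, ξ)) (by fun_prop)
      fun_prop
    have hfm := hs.measurable
    rw [hH, lintegral_const_mul _ (by fun_prop), lintegral_comp_const_mul_real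
      (-(2 * Real.pi)⁻¹) (by simp [Real.pi_ne_zero]) hFv, hF,
      lintegral_fourier _ (P.integrable_mul v hf) (P.memLp_mul v hf), ← mul_assoc,
      ← ENNReal.ofReal_mul (by positivity), ← lintegral_const_mul _ (by fun_prop)]
    congr 1
    ext x
    rw [enorm_mul, mul_pow, ← mul_assoc, ← mul_assoc]
    congr 1
    rw [← ofReal_norm, ← ENNReal.ofReal_pow (norm_nonneg _), ← ENNReal.ofReal_mul (by positivity),
      ← ENNReal.ofReal_mul (by positivity), norm_exp, ← Real.exp_nat_mul]
    congr 1
    have h₁ : |(-(2 * Real.pi)⁻¹)⁻¹| = 2 * Real.pi := by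
      rw [inv_neg, inv_inv, abs_neg, abs_of_pos (by positivity)]
    have h₂ : Real.exp (-(v + P.c.im * x) ^ 2 / P.c.im) = Real.exp (-v ^ 2 / P.c.im) *
        Real.exp ((2 : ℕ) * (-v * x + I * P.c / 2 * x ^ 2).re) := by
      rw [← Real.exp_add]
      congr 1
      simp [← ofReal_pow]
      field_simp
      ring
    rw [h₁, h₂]
    ring
  have hfm := hs.measurable
  have hb2 : ENNReal.ofReal (‖P.b‖ ^ 2) ≠ 0 := by
    have := norm_pos_iff.2 P.b_ne_zero
    exact (ENNReal.ofReal_pos.2 (by positivity)).ne'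
  refine (ENNReal.mul_right_inj hb2 ENNReal.ofReal_ne_top).1 ?_
  rw [lintegral_congr e₁, lintegral_comp_const_mul P.b P.b_ne_zero (h := fun w => H w.re w.im)
    (hHm.comp (f := fun w : ℂ => (w.re, w.im)) (by fun_prop)),
    ← volume_preserving_equiv_real_prod.symm.lintegral_comp_emb
      measurableEquivRealProd.symm.measurableEmbedding]
  change ∫⁻ p : ℝ × ℝ, H p.1 p.2 = _
  rw [Measure.volume_eq_prod, lintegral_prod_symm' _ hHm, lintegral_congr e₂,
    lintegral_lintegral_swap (by fun_prop)]
  have e₃ : ∀ x, ∫⁻ v : ℝ, ENNReal.ofReal (P.const ^ 2 * (2 * Real.pi)) *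
      (ENNReal.ofReal (Real.exp (-(v + P.c.im * x) ^ 2 / P.c.im)) * ‖f x‖ₑ ^ 2) =
      ENNReal.ofReal (‖P.b‖ ^ 2) * ‖f x‖ₑ ^ 2 := fun x => by
    rw [lintegral_const_mul _ (by fun_prop), lintegral_mul_const _ (by fun_prop),
      lintegral_gaussian _ hc, ← mul_assoc, ← ENNReal.ofReal_mul (by positivity), const_sq]
  rw [lintegral_congr e₃, lintegral_const_mul _ (by fun_prop)]

theorem stronglyMeasurable_transform {f : ℝ → ℂ} (hs : StronglyMeasurable f) :
    StronglyMeasurable (P.transform f) := by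
  refine StronglyMeasurable.const_mul (StronglyMeasurable.integral_prod_right
    (f := fun (z : ℂ) (x : ℝ) => exp (I * P.phase z x) * f x) ?_) _
  refine StronglyMeasurable.mul (Continuous.stronglyMeasurable ?_)
    (hs.comp_measurable measurable_snd)
  unfold phase
  fun_prop

theorem eLpNorm_transform (f : Lp ℂ 2 (volume : Measure ℝ)) :
    eLpNorm (P.transform f) 2 (expMeasure (2 • P.Phi)) = eLpNorm f 2 volume := by
  have h := P.lintegral_transform (Lp.stronglyMeasurable f) (Lp.memLp f)
  have hm := (P.stronglyMeasurable_transform (Lp.stronglyMeasurable f)).measurable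
  have e : ∫⁻ z, ‖P.transform f z‖ₑ ^ 2 ∂expMeasure (2 • P.Phi) = ∫⁻ x, ‖f x‖ₑ ^ 2 := by
    rw [← h, expMeasure, lintegral_withDensity_eq_lintegral_mul _ (by fun_prop) (by fun_prop)]
    simp only [Pi.mul_apply, mul_comm]
  rw [eLpNorm_eq_lintegral_rpow_enorm_toReal (by norm_num) (by norm_num),
    eLpNorm_eq_lintegral_rpow_enorm_toReal (by norm_num) (by norm_num)]
  simp only [ENNReal.toReal_ofNat, ENNReal.rpow_ofNat]
  rw [e]

theorem memLp_transform (f : Lp ℂ 2 (volume : Measure ℝ)) :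
    MemLp (P.transform f) 2 (expMeasure (2 • P.Phi)) :=
  ⟨(P.stronglyMeasurable_transform (Lp.stronglyMeasurable f)).aestronglyMeasurable, by
    rw [eLpNorm_transform]; exact Lp.eLpNorm_lt_top f⟩

theorem transform_congr {f g : ℝ → ℂ} (h : f =ᵐ[volume] g) : P.transform f = P.transform g := by
  ext z
  unfold transform
  congr 1
  refine integral_congr_ae ?_
  filter_upwards [h] with x hx
  rw [hx]

theorem transform_add {f g : ℝ → ℂ} (hf : MemLp f 2) (hg : MemLp g 2) :
    P.transform (f + g) = P.transform f + P.transform g := by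
  ext z
  simp only [transform, Pi.add_apply, mul_add]
  rw [integral_add (P.integrable_transform hf z) (P.integrable_transform hg z), mul_add]

theorem transform_smul (r : ℂ) (f : ℝ → ℂ) : P.transform (r • f) = r • P.transform f := by
  ext z
  simp only [transform, Pi.smul_apply, smul_eq_mul, mul_left_comm _ r, integral_const_mul]

/-- The Bargmann-type transform as a bounded operator `T : L²(ℝ) → L²_Φ(ℂ)`: the class of `f` is
sent to the class of `z ↦ Tf(z)`. -/
def T : Lp ℂ 2 (volume : Measure ℝ) →L[ℂ] P.L2Phi :=
  LinearMap.mkContinuous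
    { toFun := fun f => (P.memLp_transform f).toLp
      map_add' := fun f g => by
        rw [← MemLp.toLp_add, MemLp.toLp_eq_toLp_iff,
          P.transform_congr (Lp.coeFn_add f g), P.transform_add (Lp.memLp f) (Lp.memLp g)]
      map_smul' := fun r f => by
        rw [RingHom.id_apply, ← MemLp.toLp_const_smul, MemLp.toLp_eq_toLp_iff,
          P.transform_congr (Lp.coeFn_smul r f), P.transform_smul] }
    1 fun f => by
      rw [one_mul, LinearMap.coe_mk, AddHom.coe_mk, Lp.norm_toLp, eLpNorm_transform, Lp.norm_def]

/-- The Hilbert space adjoint `T* : L²_Φ(ℂ) → L²(ℝ)` of the Bargmann-type transform, that is,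
`(Tf, F)_{L²_Φ} = (f, T*F)_{L²}`. -/
def Tstar : P.L2Phi →L[ℂ] Lp ℂ 2 (volume : Measure ℝ) := ContinuousLinearMap.adjoint P.T

end QuadraticPhase

/-- The phase `φ(z, x) = (i / 4) z² - i z x + (i / 2) x²` of the standard Bargmann transform. -/
def standardPhase : QuadraticPhase where
  a := I / 2
  b := -I
  c := I
  b_ne_zero := neg_ne_zero.2 I_ne_zero
  im_c_pos := by simp

/-- The standard Bargmann transform
`Bf(z) = 2^{-1/2} π^{-3/4} ∫ e^{-z²/4 + zx - x²/2} f(x) dx`. -/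
def B (f : ℝ → ℂ) (z : ℂ) : ℂ :=
  ((2 : ℝ) ^ (-(1 / 2) : ℝ) * Real.pi ^ (-(3 / 4) : ℝ) : ℝ) *
    ∫ x : ℝ, exp (-z ^ 2 / 4 + z * x - x ^ 2 / 2) * f x

/-- The standard Bargmann transform is the Bargmann-type transform of the standard phase. -/
theorem B_eq (f : ℝ → ℂ) : B f = standardPhase.transform f := by
  ext z
  have h : ∀ x : ℝ, -z ^ 2 / 4 + z * x - x ^ 2 / 2 = I * standardPhase.phase z x := fun x => by
    simp only [QuadraticPhase.phase, standardPhase]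
    linear_combination (-z ^ 2 / 4 + z * x - x ^ 2 / 2) * I_sq
  simp only [B, QuadraticPhase.transform, h]
  congr 2
  simp [QuadraticPhase.const, standardPhase]

end Bargmann

end

/-! The hypotheses on `a`, `b`, `c` say exactly that the weight of `X s` is `2Φ`, and the weight of
`HB` is `2Φ` for the standard phase, whose transform is `B`. It therefore suffices to prove, for an
arbitrary phase, that `T` is unitary from `L²(ℝ)` onto the entire functions in `L²_Φ`. Its inverse
is then `T*` restricted to them, and `B ∘ T*` is a composition of two unitary maps.

That `T` is isometric is the Plancherel computation `eLpNorm_transform`; that its values are entire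
is differentiation under the integral. The main point is surjectivity. Write `2Φ = k|z|² + 2 Re g`
with `g` entire. A suitable Gaussian `γ_w` satisfies `T γ_w(z) = C e^{g(z)} e^{k z conj w}`
(`transform_gaussian`), which is a multiple of the reproducing kernel at `w`: pairing it with an
entire `φ` in `L²_Φ` gives a nonzero multiple of `φ(w) e^{-g(w)}` (`integral_mul_exp_mul_gaussian`,
a translated mean value property). So only `0` is orthogonal to the range, and this applies to `φ -
T T* φ`. -/

noncomputable section

open MeasureTheory Complex
open scoped ComplexConjugate ENNReal InnerProductSpace

namespace Bargmann

/-! ### Mean value and reproducing properties for Gaussian weights -/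

/-- Averaging over the rotations about the origin: the mean value property of entire functions
holds with respect to a rotation invariant Gaussian weight. -/
theorem integral_mul_gaussian {ψ : ℂ → ℂ} (hψ : Differentiable ℂ ψ) (k : ℝ)
    (hi : Integrable fun z : ℂ => ψ z * Real.exp (-(k * ‖z‖ ^ 2))) :
    ∫ z : ℂ, ψ z * Real.exp (-(k * ‖z‖ ^ 2)) =
      ψ 0 * ∫ z : ℂ, (Real.exp (-(k * ‖z‖ ^ 2)) : ℂ) := by
  set F : ℂ → ℂ := fun z => ψ z * Real.exp (-(k * ‖z‖ ^ 2)) with hF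
  have hFc : Continuous F := hψ.continuous.mul (by fun_prop)
  have hrot (θ : ℝ) : MeasurePreserving (fun z : ℂ => circleMap 0 1 θ * z) volume volume := by
    have h := (rotation (Circle.exp θ)).measurePreserving
    refine (funext fun z => ?_ : (⇑(rotation (Circle.exp θ)) = fun z : ℂ => circleMap 0 1 θ * z)) ▸ h
    simp [circleMap, rotation_apply]
  have hemb (θ : ℝ) : MeasurableEmbedding (fun z : ℂ => circleMap 0 1 θ * z) :=
    (Homeomorph.mulLeft₀ (circleMap 0 1 θ) (circleMap_ne_center one_ne_zero)).measurableEmbedding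
  have e₁ (θ : ℝ) : ∫ z, F (circleMap 0 1 θ * z) = ∫ z, F z :=
    (hrot θ).integral_comp (hemb θ) F
  -- For fixed `z` the function `ζ ↦ ψ (ζ z)` is entire with value `ψ 0` at the origin, while the
  -- Gaussian factor is constant on `|ζ| = 1`.
  have e₂ (z : ℂ) : ∫ θ in (0 : ℝ)..2 * Real.pi, F (circleMap 0 1 θ * z) =
      (2 * Real.pi) • (ψ 0 * Real.exp (-(k * ‖z‖ ^ 2))) := by
    have hm := (hψ.comp (differentiable_id.mul_const z)).diffContOnCl
      (s := Metric.ball 0 |1|) |>.circleAverage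
    simp only [Real.circleAverage, Function.comp_apply, id_eq, zero_mul] at hm
    have hp : (2 * Real.pi) ≠ 0 := by positivity
    rw [inv_smul_eq_iff₀ hp] at hm
    simp only [hF, norm_mul, norm_circleMap_zero, abs_one, one_mul]
    rw [intervalIntegral.integral_mul_const, hm, smul_mul_assoc]
  -- Fubini applies because, by rotation invariance, the `L¹` norm in `z` does not depend on `θ`.
  have hprod : Integrable (Function.uncurry fun (θ : ℝ) (z : ℂ) => F (circleMap 0 1 θ * z))
      ((volume.restrict (Set.uIoc 0 (2 * Real.pi))).prod volume) := by
    refine (integrable_prod_iff ?_).2 ⟨Filter.Eventually.of_forall fun θ => ?_, ?_⟩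
    · refine Continuous.aestronglyMeasurable (hFc.comp ?_)
      exact ((continuous_circleMap 0 1).comp continuous_fst).mul continuous_snd
    · exact (hrot θ).integrable_comp_of_integrable hi
    · have (θ : ℝ) : ∫ z, ‖F (circleMap 0 1 θ * z)‖ = ∫ z, ‖F z‖ :=
        (hrot θ).integral_comp (hemb θ) fun z => ‖F z‖
      simp only [Function.uncurry_apply_pair, this]
      rw [Set.uIoc_of_le Real.two_pi_pos.le]
      exact integrable_const _
  have hsw := intervalIntegral_integral_swap hprod
  simp only [e₁, e₂] at hsw
  rw [intervalIntegral.integral_const, integral_smul, sub_zero] at hsw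
  rw [smul_right_injective ℂ (by positivity : 2 * Real.pi ≠ 0) hsw, integral_const_mul]

/-- The reproducing property of the kernel `e^{k z conj w}`, up to the normalizing constant. -/
theorem integral_mul_exp_mul_gaussian {F : ℂ → ℂ} (hF : Differentiable ℂ F) (k : ℝ) (w : ℂ)
    (hi : Integrable fun z : ℂ => F z * exp (k * (conj z * w)) * Real.exp (-(k * ‖z‖ ^ 2))) :
    ∫ z : ℂ, F z * exp (k * (conj z * w)) * Real.exp (-(k * ‖z‖ ^ 2)) =
      F w * ∫ z : ℂ, (Real.exp (-(k * ‖z‖ ^ 2)) : ℂ) := by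
  -- Moving `w` to the origin cancels the antiholomorphic terms of the exponent, so the factor left
  -- in front of the centred Gaussian is entire, with value `F w` at `0`.
  have h (z : ℂ) : F (z + w) * exp (k * (conj (z + w) * w)) * Real.exp (-(k * ‖z + w‖ ^ 2)) =
      F (z + w) * exp (-(k * (z * conj w))) * Real.exp (-(k * ‖z‖ ^ 2)) := by
    simp only [ofReal_exp, mul_assoc, ← exp_add]
    congr 2
    push_cast
    rw [← mul_conj', ← mul_conj', map_add]
    ring
  have hi' := hi.comp_add_right w
  rw [← integral_add_right_eq_self _ w]
  simp only [h] at hi' ⊢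
  rw [integral_mul_gaussian (by fun_prop) k hi']
  simp

/-! ### The weighted spaces inside `L²` -/

namespace EntireL2

variable {q : C(ℂ, ℝ)}

theorem integrable_inner (φ ψ : EntireL2 q) :
    Integrable fun z => conj (φ z) * ψ z * Real.exp (-q z) := by
  have h := L2.integrable_inner (𝕜 := ℂ) (φ.memLp.toLp φ) (ψ.memLp.toLp ψ)
  have h' : Integrable (fun z => conj (φ z) * ψ z) (expMeasure q) := by
    refine h.congr ?_
    filter_upwards [φ.memLp.coeFn_toLp, ψ.memLp.coeFn_toLp] with z h₁ h₂
    rw [h₁, h₂, RCLike.inner_apply, mul_comm]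
  rw [expMeasure, integrable_withDensity_iff_integrable_smul' (by fun_prop) (by simp)] at h'
  refine h'.congr (Filter.Eventually.of_forall fun z => ?_)
  simp only [ENNReal.toReal_ofReal (Real.exp_pos _).le, Complex.real_smul]
  ring

theorem norm_eq_norm_toLp (φ : EntireL2 q) : ‖φ‖ = ‖φ.memLp.toLp φ‖ := by
  rw [@norm_eq_sqrt_re_inner ℂ, @norm_eq_sqrt_re_inner ℂ, inner_eq]

end EntireL2

/-! ### Holomorphy of the transform -/

namespace QuadraticPhase

variable (P : QuadraticPhase)

/-- Differentiation under the integral: near `w` the derivative of the integrand is dominated by two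
integrands with real exponents `±A`, integrable by `integrable_mul`. -/
theorem differentiableAt_integral_kernel {f : ℝ → ℂ} (hf : MemLp f 2) (w : ℂ) :
    DifferentiableAt ℂ (fun w : ℂ => ∫ x : ℝ, exp (w * x + I * P.c / 2 * x ^ 2) * f x) w := by
  -- One unit covers the ball of radius `1` about `w`; the other absorbs the factor `|x| ≤ e^{|x|}`
  -- produced by the derivative.
  set A : ℝ := ‖w‖ + 2
  have hb (v : ℝ) := (P.integrable_mul v hf).norm
  refine (hasDerivAt_integral_of_dominated_loc_of_deriv_le (Metric.ball_mem_nhds w one_pos)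
    (μ := (volume : Measure ℝ)) (F := fun (w : ℂ) (x : ℝ) => exp (w * x + I * P.c / 2 * x ^ 2) * f x)
    (F' := fun (w : ℂ) (x : ℝ) => x * (exp (w * x + I * P.c / 2 * x ^ 2) * f x))
    (bound := fun x => ‖exp (-(A : ℝ) * x + I * P.c / 2 * x ^ 2) * f x‖ +
      ‖exp (-(-A : ℝ) * x + I * P.c / 2 * x ^ 2) * f x‖)
    (Filter.Eventually.of_forall fun w => ?_) ?_ ?_ (Filter.Eventually.of_forall fun x u hu => ?_)
    ((hb A).add (hb (-A))) (Filter.Eventually.of_forall fun x u hu => ?_)).2.differentiableAt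
  · exact (by fun_prop : Continuous _).aestronglyMeasurable.mul hf.1
  · have h := ((P.integrable_mul (-w.re) hf).bdd_mul (c := 1)
      (f := fun x : ℝ => exp (↑(w.im * x) * I))
      (by fun_prop) (Filter.Eventually.of_forall fun x => by rw [norm_exp_ofReal_mul_I]))
    refine h.congr (Filter.Eventually.of_forall fun x => ?_)
    simp only [← mul_assoc, ← exp_add]
    congr 2
    conv_rhs => rw [← re_add_im w]
    push_cast
    ring
  · exact (by fun_prop : Continuous fun x : ℝ => (x : ℂ)).aestronglyMeasurable.mul
      ((by fun_prop : Continuous _).aestronglyMeasurable.mul hf.1)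
  · have hre : |u.re| ≤ A - 1 := by
      have h₁ := Metric.mem_ball.1 hu
      have h₂ := norm_le_norm_add_norm_sub' u w
      rw [dist_eq_norm] at h₁
      have h₃ := abs_re_le_norm u
      linarith
    have hx : |x| * Real.exp (u.re * x) ≤ Real.exp (A * |x|) := by
      have h₁ : |x| ≤ Real.exp |x| := by linarith [Real.add_one_le_exp |x|]
      have h₂ : u.re * x ≤ (A - 1) * |x| := by
        refine (le_abs_self _).trans ?_
        rw [abs_mul]
        gcongr
      calc |x| * Real.exp (u.re * x) ≤ Real.exp |x| * Real.exp ((A - 1) * |x|) := by gcongr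
        _ = Real.exp (A * |x|) := by rw [← Real.exp_add]; congr 1; ring
    have hs : Real.exp (A * |x|) ≤ Real.exp (-A * x) + Real.exp (A * x) := by
      rcases abs_choice x with h | h <;> rw [h]
      · linarith [Real.exp_pos (-A * x)]
      · rw [mul_neg, ← neg_mul]; linarith [Real.exp_pos (A * x)]
    have hn (v : ℂ) : ‖exp (v * x + I * P.c / 2 * x ^ 2)‖ =
        Real.exp (v.re * x) * ‖exp (I * P.c / 2 * x ^ 2)‖ := by
      rw [exp_add, norm_mul, norm_exp (v * x), re_mul_ofReal]
    have h₁ := hn (-(A : ℝ))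
    have h₂ := hn (-(-A : ℝ))
    rw [neg_re, ofReal_re] at h₁ h₂
    rw [neg_neg] at h₂
    rw [norm_mul, norm_mul, norm_mul, norm_mul, hn u, norm_real, Real.norm_eq_abs]
    push_cast at h₁ h₂ ⊢
    rw [h₁, h₂]
    calc _ = (|x| * Real.exp (u.re * x)) * (‖exp (I * P.c / 2 * x ^ 2)‖ * ‖f x‖) := by ring
      _ ≤ (Real.exp (-A * x) + Real.exp (A * x)) * (‖exp (I * P.c / 2 * x ^ 2)‖ * ‖f x‖) := by
        gcongr
        exact hx.trans hs
      _ = _ := by ring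
  · have h := ((((hasDerivAt_id u).mul_const (x : ℂ)).add_const
      (I * P.c / 2 * x ^ 2)).cexp).mul_const (f x)
    refine h.congr_deriv ?_
    simp only [id_eq]
    ring

theorem differentiable_transform {f : ℝ → ℂ} (hf : MemLp f 2) :
    Differentiable ℂ (P.transform f) := by
  -- The phase depends on `x` and `z` jointly only through `b z x`, so the integral is the previous
  -- one evaluated at `i b z`.
  have e : P.transform f = fun z => P.const * (exp (I * P.a / 2 * z ^ 2) *
      (fun w : ℂ => ∫ x : ℝ, exp (w * x + I * P.c / 2 * x ^ 2) * f x) (I * P.b * z)) := by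
    ext z
    simp only [transform]
    rw [← integral_const_mul (exp (I * P.a / 2 * z ^ 2))]
    congr 2
    ext x
    rw [← mul_assoc, ← exp_add, phase]
    congr 2
    ring
  have h : Differentiable ℂ (fun w : ℂ => ∫ x : ℝ, exp (w * x + I * P.c / 2 * x ^ 2) * f x) :=
    fun w => P.differentiableAt_integral_kernel hf w
  rw [e]
  have h' := h.comp (differentiable_id.const_mul (I * P.b))
  exact ((by fun_prop : Differentiable ℂ fun z => exp (I * P.a / 2 * z ^ 2)).mul h').const_mul _

/-- The Bargmann-type transform with values in the space of entire functions. -/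
def entireTransform (f : Lp ℂ 2 (volume : Measure ℝ)) : EntireL2 (2 • P.Phi) :=
  ⟨P.transform f, P.differentiable_transform (Lp.memLp f), P.memLp_transform f⟩

/-! ### Radial and pluriharmonic parts of the weight -/

/-- The constant `|b|² / (2 Im c)` of the rotation invariant part of the weight `2 Φ`. -/
def rate : ℝ := ‖P.b‖ ^ 2 / (2 * P.c.im)

/-- The entire function `g` with `2 Φ(z) = |b|² / (2 Im c) |z|² + 2 Re g(z)`. -/
def holPart (z : ℂ) : ℂ := I * P.a / 2 * z ^ 2 - P.b ^ 2 * z ^ 2 / (4 * P.c.im)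

theorem rate_pos : 0 < P.rate := by
  have := P.im_c_pos
  have := norm_pos_iff.2 P.b_ne_zero
  unfold rate
  positivity

theorem two_smul_Phi_apply (z : ℂ) :
    (2 • P.Phi) z = P.rate * ‖z‖ ^ 2 + 2 * (P.holPart z).re := by
  have hc := P.im_c_pos.ne'
  have h₁ : (P.b ^ 2 * z ^ 2 + conj P.b ^ 2 * conj z ^ 2).re = 2 * (P.b ^ 2 * z ^ 2).re := by
    simp [pow_two]; ring
  have h₂ : ((P.a * z ^ 2 - conj P.a * conj z ^ 2) / (4 * I)).re = (P.a * z ^ 2).im / 2 := by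
    have : P.a * z ^ 2 - conj P.a * conj z ^ 2 = (2 * (P.a * z ^ 2).im : ℝ) * I := by
      rw [← sub_conj]; simp
    rw [this, mul_div_mul_right _ _ I_ne_zero]
    norm_cast
    ring
  have h₃ : (P.holPart z).re = -(P.a * z ^ 2).im / 2 - (P.b ^ 2 * z ^ 2).re / (4 * P.c.im) := by
    have : P.holPart z = I * (P.a * z ^ 2) / (2 : ℝ) -
        P.b ^ 2 * z ^ 2 / ((4 * P.c.im : ℝ) : ℂ) := by
      unfold holPart; push_cast; ring
    rw [this, sub_re, div_ofReal_re, div_ofReal_re, I_mul_re]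
  have h₄ : (2 • P.Phi) z = 2 * (‖P.b * z‖ ^ 2 / (4 * P.c.im)
      - (P.b ^ 2 * z ^ 2 + conj P.b ^ 2 * conj z ^ 2).re / (8 * P.c.im)
      - ((P.a * z ^ 2 - conj P.a * conj z ^ 2) / (4 * I)).re) := by
    simp [Phi, two_mul]
  rw [h₄, h₁, h₂, h₃, norm_mul, rate]
  field_simp
  ring

/-! ### Reproducing kernels in the range, and its density -/

/-- The Gaussian whose transform is a multiple of the reproducing kernel at `w`. -/
def gaussian (w : ℂ) (x : ℝ) : ℂ := exp (-(I * conj P.b * conj w) * x - I * conj P.c / 2 * x ^ 2)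

theorem memLp_gaussian (w : ℂ) : MemLp (P.gaussian w) 2 := by
  unfold gaussian
  refine (memLp_two_iff_integrable_sq_norm (by fun_prop)).2 ?_
  have h := (integrable_cexp_quadratic (b := P.c.im) (by simpa using P.im_c_pos)
    (-2 * (I * conj P.b * conj w)) 0).norm
  refine h.congr (Filter.Eventually.of_forall fun x => ?_)
  simp only [norm_exp, ← Real.exp_nat_mul]
  congr 1
  simp [← ofReal_pow]
  ring

/-- Up to a factor independent of `x`, the Gaussian is the conjugate of `e^{iφ(w, x)}`, so the
integrand is the exponential of a quadratic in `x` with leading coefficient `-Im c`. Completing the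
square yields `-(bz - conj (bw))² / (4 Im c)`: its `z²` term enters `holPart`, its cross term is
`rate * (z * conj w)`, and its `(conj w)²` term goes into `C`. -/
theorem transform_gaussian (w : ℂ) : ∃ C : ℂ, C ≠ 0 ∧ ∀ z,
    P.transform (P.gaussian w) z = C * exp (P.holPart z) * exp (P.rate * (z * conj w)) := by
  have hc := P.im_c_pos
  have hc' : (P.c.im : ℂ) ≠ 0 := ofReal_ne_zero.2 hc.ne'
  have hI : I * P.c / 2 - I * conj P.c / 2 = -P.c.im := by
    have := sub_conj P.c
    push_cast at this
    linear_combination I / 2 * this + P.c.im * I_sq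
  refine ⟨P.const * (Real.pi / -(-P.c.im : ℂ)) ^ (1 / 2 : ℂ) *
    exp (-(conj P.b * conj w) ^ 2 / (4 * P.c.im)), ?_, fun z => ?_⟩
  · refine mul_ne_zero (mul_ne_zero (ofReal_ne_zero.2 P.const_pos.ne') ?_) (exp_ne_zero _)
    rw [neg_neg, cpow_ne_zero_iff_of_exponent_ne_zero (by norm_num)]
    exact div_ne_zero (ofReal_ne_zero.2 Real.pi_ne_zero) hc'
  · have e (x : ℝ) : exp (I * P.phase z x) * P.gaussian w x =
        exp (-P.c.im * x ^ 2 + (I * P.b * z - I * conj P.b * conj w) * x +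
          I * P.a / 2 * z ^ 2) := by
      rw [gaussian, ← exp_add, phase, ← hI]
      congr 1
      ring
    rw [transform]
    simp only [e]
    rw [integral_cexp_quadratic (by simpa using hc), mul_assoc _ (exp _) (exp _), ← exp_add,
      mul_assoc _ (exp _) (exp _), ← exp_add, ← mul_assoc]
    congr 2
    rw [rate, holPart]
    push_cast
    rw [← mul_conj']
    field_simp
    linear_combination 2 * (P.b * z - conj P.b * conj w) ^ 2 * I_sq

/-- An entire function that is orthogonal to the range of the transform vanishes. -/
theorem eq_zero_of_inner_entireTransform (φ : EntireL2 (2 • P.Phi))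
    (h : ∀ f, ⟪P.entireTransform f, φ⟫_ℂ = 0) : φ = 0 := by
  refine Subtype.ext (funext fun w => ?_)
  change φ w = 0
  obtain ⟨C, hC, hT⟩ := P.transform_gaussian w
  set f := (P.memLp_gaussian w).toLp _ with hf
  have hT' : ⇑(P.entireTransform f) = P.transform (P.gaussian w) :=
    P.transform_congr (P.memLp_gaussian w).coeFn_toLp
  have hg : Differentiable ℂ P.holPart := by unfold holPart; fun_prop
  -- Since `e^{-2Φ} = e^{-g} e^{-conj g} e^{-k|z|²}`, the factor `conj (e^g)` of the conjugated
  -- kernel cancels `e^{-conj g}`, and the entire function `φ e^{-g}` remains against a radial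
  -- Gaussian.
  set F : ℂ → ℂ := fun z => φ z * exp (-P.holPart z) with hF
  have hFd : Differentiable ℂ F := φ.differentiable.mul hg.neg.cexp
  have e (z : ℂ) : conj (P.entireTransform f z) * φ z * Real.exp (-(2 • P.Phi) z) =
      conj C * (F z * exp (P.rate * (conj z * w)) * Real.exp (-(P.rate * ‖z‖ ^ 2))) := by
    have h₁ : ((2 * (P.holPart z).re : ℝ) : ℂ) = P.holPart z + conj (P.holPart z) :=
      (add_conj _).symm
    have h₂ : (Real.exp (-(2 • P.Phi) z) : ℂ) = exp (-P.holPart z) * exp (-conj (P.holPart z)) *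
        Real.exp (-(P.rate * ‖z‖ ^ 2)) := by
      rw [two_smul_Phi_apply, ofReal_exp, ofReal_exp, ← exp_add, ← exp_add, neg_add,
        ofReal_add, ofReal_neg (2 * _), h₁]
      congr 1
      ring
    have h₃ : exp (conj (P.holPart z)) * exp (-conj (P.holPart z)) = 1 := by
      rw [← exp_add, add_neg_cancel, exp_zero]
    rw [hT', hT, h₂, hF]
    simp only [map_mul, ← exp_conj, conj_ofReal, conj_conj]
    linear_combination (conj C * exp (P.rate * (conj z * w)) * φ z * exp (-P.holPart z) *
      Real.exp (-(P.rate * ‖z‖ ^ 2))) * h₃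
  have hi := EntireL2.integrable_inner (P.entireTransform f) φ
  have h₀ : ∫ z, conj (P.entireTransform f z) * φ z * Real.exp (-(2 • P.Phi) z) = 0 := h f
  have hC' : conj C ≠ 0 := (map_ne_zero _).2 hC
  simp only [e] at hi h₀
  rw [integrable_const_mul_iff (IsUnit.mk0 _ hC')] at hi
  rw [integral_const_mul, integral_mul_exp_mul_gaussian hFd _ _ hi] at h₀
  have hG : ∫ z : ℂ, (Real.exp (-(P.rate * ‖z‖ ^ 2)) : ℂ) ≠ 0 := by
    have := GaussianFourier.integral_rexp_neg_mul_sq_norm (V := ℂ) P.rate_pos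
    simp only [neg_mul] at this
    rw [integral_complex_ofReal, this]
    have := P.rate_pos
    exact ofReal_ne_zero.2 (by positivity)
  rw [mul_eq_zero_iff_left hC', mul_eq_zero_iff_right hG] at h₀
  simpa [hF] using h₀

/-! ### Unitarity of the transform -/

theorem T_eq (f : Lp ℂ 2 (volume : Measure ℝ)) :
    P.T f = (P.entireTransform f).memLp.toLp (P.entireTransform f) := rfl

theorem norm_T (f : Lp ℂ 2 (volume : Measure ℝ)) : ‖P.T f‖ = ‖f‖ := by
  rw [Lp.norm_def f, ← P.eLpNorm_transform f]
  exact Lp.norm_toLp _ (P.memLp_transform f)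

theorem Tstar_T (f : Lp ℂ 2 (volume : Measure ℝ)) : P.Tstar (P.T f) = f :=
  DFunLike.congr_fun ((ContinuousLinearMap.norm_map_iff_adjoint_comp_self P.T).1 P.norm_T) f

/-- The difference `φ - T T* φ` is orthogonal to the range: pairing `T f` with either term gives
`(f, T* φ)`, because `T* T = 1`. -/
theorem entireTransform_Tstar (φ : EntireL2 (2 • P.Phi)) :
    P.entireTransform (P.Tstar (φ.memLp.toLp φ)) = φ := by
  refine (sub_eq_zero.1 (P.eq_zero_of_inner_entireTransform _ fun f => ?_)).symm
  rw [inner_sub_right, EntireL2.inner_eq, EntireL2.inner_eq, ← T_eq, ← T_eq,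
    ← ContinuousLinearMap.adjoint_inner_right, ← ContinuousLinearMap.adjoint_inner_right]
  change ⟪f, P.Tstar _⟫_ℂ - ⟪f, P.Tstar _⟫_ℂ = 0
  rw [Tstar_T, sub_self]

/-- The Bargmann-type transform is unitary from `L²(ℝ)` onto the space of entire functions in
`L²_Φ(ℂ)`, with inverse the restriction of the adjoint. -/
def unitary : Lp ℂ 2 (volume : Measure ℝ) ≃ₗᵢ[ℂ] EntireL2 (2 • P.Phi) where
  toFun := P.entireTransform
  invFun φ := P.Tstar (φ.memLp.toLp φ)
  left_inv := P.Tstar_T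
  right_inv := P.entireTransform_Tstar
  map_add' f g := Subtype.ext <|
    (P.transform_congr (Lp.coeFn_add f g)).trans (P.transform_add (Lp.memLp f) (Lp.memLp g))
  map_smul' r f := Subtype.ext <|
    (P.transform_congr (Lp.coeFn_smul r f)).trans (P.transform_smul r f)
  norm_map' f := by
    rw [EntireL2.norm_eq_norm_toLp]
    exact P.norm_T f

end QuadraticPhase

/-! ### Identification of the weights and conclusion -/

/-- The transfer of entire functions between two weighted spaces by means of two phases. -/
theorem exists_linearIsometryEquiv {q q' : C(ℂ, ℝ)} (P Q : QuadraticPhase)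
    (hq : q = 2 • P.Phi) (hq' : q' = 2 • Q.Phi) :
    ∃ U : EntireL2 q ≃ₗᵢ[ℂ] EntireL2 q', ∀ φ : EntireL2 q,
      ∃ hφ : MemLp φ 2 (expMeasure (2 • P.Phi)),
        ∀ z : ℂ, U φ z = Q.transform (P.Tstar (hφ.toLp φ)) z := by
  subst hq hq'
  exact ⟨P.unitary.symm.trans Q.unitary, fun φ => ⟨φ.memLp, fun z => rfl⟩⟩

/-- For the standard phase `rate` is `1/2`, and the two terms of `holPart` are `-z²/4` and `z²/4`.
-/
theorem weight_standardPhase :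
    (⟨fun z => ‖z‖ ^ 2 / 2, by fun_prop⟩ : C(ℂ, ℝ)) = 2 • standardPhase.Phi := by
  ext z
  rw [QuadraticPhase.two_smul_Phi_apply]
  have h : standardPhase.holPart z = 0 := by
    simp only [QuadraticPhase.holPart, standardPhase, I_im, ofReal_one]
    ring
  rw [h]
  simp [QuadraticPhase.rate, standardPhase]
  ring

/-- The first relation fixes `rate`. As `i a / 2 = -a / (2i)`, the second fixes `holPart` as `-(1 +
s²) / (4s) z²`. Together these two determine `2Φ`. -/
theorem weight_eq_two_smul_Phi {s : ℝ} (P : QuadraticPhase)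
    (h₁ : (1 - s ^ 2) / (4 * s) = ‖P.b‖ ^ 2 / (4 * P.c.im))
    (h₂ : (1 + (s : ℂ) ^ 2) / (4 * s) = P.b ^ 2 / (4 * P.c.im) + P.a / (2 * I)) :
    (⟨fun z => (1 - s ^ 2) / (2 * s) * ‖z‖ ^ 2
      - (1 + s ^ 2) / (4 * s) * (z ^ 2 + conj z ^ 2).re, by fun_prop⟩ : C(ℂ, ℝ)) = 2 • P.Phi := by
  ext z
  rw [QuadraticPhase.two_smul_Phi_apply]
  have hr : P.rate = (1 - s ^ 2) / (2 * s) := by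
    calc P.rate = 2 * (‖P.b‖ ^ 2 / (4 * P.c.im)) := by rw [QuadraticPhase.rate]; ring
      _ = _ := by rw [← h₁]; ring
  have hg : P.holPart z = -(((1 + s ^ 2) / (4 * s) : ℝ) * z ^ 2) := by
    push_cast
    rw [h₂, QuadraticPhase.holPart, ← div_div P.a, div_I]
    ring
  have hz : (z ^ 2 + conj z ^ 2).re = 2 * (z ^ 2).re := by
    rw [← map_pow, add_conj, ofReal_re]
  rw [hr, hg, neg_re, re_ofReal_mul]
  simp only [ContinuousMap.coe_mk, hz]
  ring

end Bargmann

end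

theorem theorem3p2 (s : ℝ) (hs₀ : 0 < s) (hs₁ : s < 1) (P : Bargmann.QuadraticPhase)
    (habc₁ : (1 - s ^ 2) / (4 * s) = ‖P.b‖ ^ 2 / (4 * P.c.im))
    (habc₂ : (1 + (s : ℂ) ^ 2) / (4 * s) = P.b ^ 2 / (4 * P.c.im) + P.a / (2 * Complex.I)) :
    ∃ U : Bargmann.X s ≃ₗᵢ[ℂ] Bargmann.HB,
      ∀ φ : Bargmann.X s,
        ∃ hφ : MeasureTheory.MemLp φ 2 (Bargmann.expMeasure (2 • P.Phi)),
          ∀ z : ℂ, U φ z = Bargmann.B (P.Tstar (hφ.toLp φ)) z := by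
  simp only [Bargmann.B_eq]
  exact Bargmann.exists_linearIsometryEquiv P Bargmann.standardPhase
    (Bargmann.weight_eq_two_smul_Phi P habc₁ habc₂) Bargmann.weight_standardPhase
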